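/- Let $\mathcal X$ be a finite set and let $X_1,X_2,\dots$ be an $\mathcal X$-valued stochastic process with $X_t\sim\pi$ for every $t\ge 1$ (for instance any stationary process with marginal law $\pi$). For an integer $\tau\ge 1$ let $$\alpha(\tau)=\sup_{t\ge 1}\ \sup\bigl\{|\mathbb P(A\cap B)-\mathbb P(A)\mathbb P(B)| : A\in\sigma(X_1,\dots,X_t),\ B\in\sigma(X_{t+\tau},X_{t+\tau+1},\dots)\bigr\}$$ be its $\alpha$-mixing coefficient. Assume that the process is exponentially $\alpha$-mixing: there are $\mu>0$ and $\rho\in(0,1)$ with $\alpha(\tau)\le\mu\rho^\tau$ for all $\tau\ge 1$. Define the mixing time $\mathsf{t_{mix}}(\epsilon)=\min\{\tau\in\{1,2,\dots\}:\alpha(\tau)\le\epsilon\}$ for $\epsilon>0$. For $x\in\mathcal X$ let $N_x=\#\{i\le n: X_i=x\}$, and for an integer $\zeta\ge 0$ let $$\varphi_\zeta=\#\{x\in\mathcal X: N_x=\zeta\},\qquad M^\pi_\zeta=\sum_{x\in\mathcal X}\pi_x\,\mathbf 1\{N_x=\zeta\},\qquad \widehat M_{\mathrm{PI},\zeta}=\varphi_\zeta\cdot\frac{\zeta}{n}.$$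 There is a universal constant $C>0$ (depending on nothing, in particular neither on $\mathcal X$ and $\pi$ nor on the law of the process) such that the following holds. Let $\delta,\epsilon>0$, let $n$ be a positive integer, and let $\tau_0=\mathsf{t_{mix}}(\epsilon/n^2)$. If $n\ge 24\tau_0$, then for each integer $$\zeta\ \ge\ \max\Bigl\{36\,\tau_0\log(22n/\delta),\ \ 1+\sqrt{(4+8\tau_0)\log(11n/\delta)}+\tfrac{4\tau_0\log(11n/\delta)}{3}\Bigr\}$$ (a square root of a negative number, which can occur only if $\delta>1$, being read as $0$), with probability at least $1-\delta-3\epsilon$, $$\bigl|M^\pi_\zeta-\widehat M_{\mathrm{PI},\zeta}\bigr|\ \le\ C\,\frac{\sqrt{\zeta\,\tau_0}\;\varphi_\zeta}{n}\,\sqrt{\log\Bigl(\frac{Cn}{\delta}\Bigr)} .$$ -/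

import Mathlib

open MeasureTheory ProbabilityTheory

namespace FreqMass

section Mixing

variable {Ω S : Type*} [MeasurableSpace Ω] [MeasurableSpace S]

/-- The σ-algebra generated by the past `X 0, …, X t`. The process is indexed from `0`, so that
`X i` is the observation usually written `X_{i+1}`. -/
@[reducible] def pastSigma (X : ℕ → Ω → S) (t : ℕ) : MeasurableSpace Ω :=
  ⨆ i : ℕ, ⨆ _ : i ≤ t, MeasurableSpace.comap (X i) inferInstance

/-- The σ-algebra generated by the future `X t, X (t + 1), …`. -/
@[reducible] def futureSigma (X : ℕ → Ω → S) (t : ℕ) : MeasurableSpace Ω :=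
  ⨆ i : ℕ, ⨆ _ : t ≤ i, MeasurableSpace.comap (X i) inferInstance

/-- The `α`-mixing coefficient at lag `τ`: the supremum of `|P(A ∩ B) - P(A) P(B)|` over all
times `t`, all past events `A ∈ σ(X_s, s ≤ t)` and all future events
`B ∈ σ(X_s, s ≥ t + τ)`. For a probability measure the set is nonempty and bounded by `1`. -/
noncomputable def alphaCoeff (P : Measure Ω) (X : ℕ → Ω → S) (τ : ℕ) : ℝ :=
  sSup {r : ℝ | ∃ (t : ℕ) (A B : Set Ω),
    MeasurableSet[pastSigma X t] A ∧ MeasurableSet[futureSigma X (t + τ)] B ∧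
    r = |P.real (A ∩ B) - P.real A * P.real B|}

/-- Exponential `α`-mixing: `α(τ) ≤ c ρ ^ τ` for all `τ ≥ 1`, for some `c > 0`, `ρ ∈ (0, 1)`. -/
def IsExpAlphaMixing (P : Measure Ω) (X : ℕ → Ω → S) : Prop :=
  ∃ c ρ : ℝ, 0 < c ∧ 0 < ρ ∧ ρ < 1 ∧ ∀ τ : ℕ, 1 ≤ τ → alphaCoeff P X τ ≤ c * ρ ^ τ

/-- The mixing time to level `ε`: the least positive integer `τ` with `α(τ) ≤ ε`. -/
noncomputable def mixTime (P : Measure Ω) (X : ℕ → Ω → S) (ε : ℝ) : ℕ :=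
  sInf {τ : ℕ | 1 ≤ τ ∧ alphaCoeff P X τ ≤ ε}

end Mixing

section Counts

variable {S : Type*} [DecidableEq S]

/-- `N_x(z)`: the number of occurrences of the symbol `x` in the sequence `z`. -/
def occCount {n : ℕ} (z : Fin n → S) (x : S) : ℕ :=
  (Finset.univ.filter fun i => z i = x).card

/-- `φ_ζ(z)`: the number of symbols that occur exactly `ζ` times in the sequence `z`. -/
def prevalence [Fintype S] {n : ℕ} (z : Fin n → S) (ζ : ℕ) : ℕ :=
  (Finset.univ.filter fun x : S => occCount z x = ζ).card

/-- The mass that `π` places on the symbols that occur exactly `ζ` times in the sequence `z`. -/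
noncomputable def countMass [Fintype S] [MeasurableSpace S] (π : Measure S) {n : ℕ}
    (z : Fin n → S) (ζ : ℕ) : ℝ :=
  ∑ x : S, π.real {x} * (if occCount z x = ζ then 1 else 0)

/-- The plug-in estimate `φ_ζ(z) ζ / n` of that mass. -/
noncomputable def plugIn [Fintype S] {n : ℕ} (z : Fin n → S) (ζ : ℕ) : ℝ :=
  (prevalence z ζ : ℝ) * ((ζ : ℝ) / (n : ℝ))

/-- The observed sequence: the first `n` values of the process. -/
def sample {Ω : Type*} (X : ℕ → Ω → S) (n : ℕ) (ω : Ω) : Fin n → S :=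
  fun i => X i ω

end Counts

end FreqMass

/-! Both `countMass` and `plugIn` are sums over the symbols seen exactly ζ times, so it is enough
that, off a small event, every such symbol satisfies |nπ_x − ζ| ≤ 6√(ζτL), where L = log(22n/δ).

For a fixed set of symbols, the visits are split by time modulo τ. Within one class, each new visit
is almost uncorrelated with the earlier count, so the tails obey the Bernoulli recursion up to an
additive α(τ) per step (`measureReal_residueCount_ge`). No coupling with an independent process is
needed. If the total is large, some class is large relative to its mean, which gives Chernoff bounds
with failure probability τe^{-3L} + nα(τ).

A union bound over all symbols would cost the alphabet size. Instead, at most n symbols have mass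
above 1/n, and the others are packed into n bins of mass at most 2/n (`exists_bins`). A light symbol
seen ζ times forces ζ visits to its bin, whose expected count is at most 2. So 2n events suffice. -/

namespace FreqMass

/-! ### Visit counts along residue classes modulo τ -/

open Finset in
/-- The number of visits to `A` at the times `i < n` in the residue class of `j` modulo `τ`. -/
noncomputable def residueCount {Ω S : Type*} (X : ℕ → Ω → S) (A : Set S) (τ j n : ℕ) (ω : Ω) : ℕ :=
  ∑ i ∈ range n with i % τ = j, A.indicator (fun _ => 1) (X i ω)

/-- The number of visits to `A` before time `n`. -/
noncomputable def visitCount {Ω S : Type*} (X : ℕ → Ω → S) (A : Set S) (n : ℕ) (ω : Ω) : ℕ :=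
  ∑ i ∈ Finset.range n, A.indicator (fun _ => 1) (X i ω)

/-- The number of times `i < n` in the residue class of `j` modulo `τ`. -/
def residueSize (τ j n : ℕ) : ℕ := ((Finset.range n).filter fun i => i % τ = j).card

theorem sum_residueSize {τ : ℕ} (hτ : 0 < τ) (n : ℕ) :
    ∑ j ∈ Finset.range τ, residueSize τ j n = n := by
  have := Finset.card_eq_sum_card_fiberwise (s := Finset.range n) (t := Finset.range τ)
    (f := fun i => i % τ) (fun i _ => by simpa using Nat.mod_lt i hτ)
  simpa [residueSize] using this.symm

theorem residueSize_le (τ j n : ℕ) :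
    (residueSize τ j n : ℝ) ≤ n / τ + 1 := by
  have h : residueSize τ j n ≤ n / τ + 1 := by
    have hsub : (Finset.range n).filter (fun i => i % τ = j)
        ⊆ (Finset.range (n / τ + 1)).image (fun k => j + τ * k) := by
      intro i hi
      simp only [Finset.mem_filter, Finset.mem_range, Finset.mem_image] at hi ⊢
      refine ⟨i / τ, ?_, ?_⟩
      · exact Nat.lt_succ_of_le (Nat.div_le_div_right hi.1.le)
      · rw [← hi.2]; exact Nat.mod_add_div i τ
    exact (Finset.card_le_card hsub).trans (Finset.card_image_le.trans (by simp))
  calc (residueSize τ j n : ℝ) ≤ ((n / τ + 1 : ℕ) : ℝ) := by exact_mod_cast h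
    _ ≤ n / τ + 1 := by push_cast; gcongr; exact Nat.cast_div_le

section Counting

variable {Ω S : Type*}

theorem sum_residueCount {τ : ℕ} (hτ : 0 < τ) (X : ℕ → Ω → S) (A : Set S) (n : ℕ) (ω : Ω) :
    ∑ j ∈ Finset.range τ, residueCount X A τ j n ω = visitCount X A n ω :=
  Finset.sum_fiberwise_of_maps_to (fun i _ => by simpa using Nat.mod_lt i hτ) _

theorem visitCount_compl (X : ℕ → Ω → S) (A : Set S) (n : ℕ) (ω : Ω) :
    visitCount X A n ω + visitCount X Aᶜ n ω = n := by
  rw [visitCount, visitCount, ← Finset.sum_add_distrib]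
  have : ∀ i ∈ Finset.range n, A.indicator (fun _ => 1) (X i ω)
      + Aᶜ.indicator (fun _ => 1) (X i ω) = 1 := by
    intro i _
    by_cases h : X i ω ∈ A <;> simp [h]
  rw [Finset.sum_congr rfl this]
  simp

theorem visitCount_mono (X : ℕ → Ω → S) {A B : Set S} (h : A ⊆ B) (n : ℕ) (ω : Ω) :
    visitCount X A n ω ≤ visitCount X B n ω :=
  Finset.sum_le_sum fun i _ => Set.indicator_le_indicator_of_subset h (by simp) _

theorem residueCount_succ (X : ℕ → Ω → S) (A : Set S) (τ j n : ℕ) (ω : Ω) :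
    residueCount X A τ j (n + 1) ω = residueCount X A τ j n ω
      + if n % τ = j then A.indicator (fun _ => 1) (X n ω) else 0 := by
  simp only [residueCount, Finset.range_add_one, Finset.filter_insert]
  split_ifs with h
  · rw [Finset.sum_insert (by simp), add_comm]
  · simp

theorem residueSize_succ (τ j n : ℕ) :
    residueSize τ j (n + 1) = residueSize τ j n + if n % τ = j then 1 else 0 := by
  simp only [residueSize, Finset.range_add_one, Finset.filter_insert]
  split_ifs with h <;> simp

/-- Earlier times in the class of n differ from n by a positive multiple of τ, hence are at most n −
τ. This gap lets the mixing coefficient at lag τ control the next visit. -/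
theorem measurable_residueCount_past [MeasurableSpace S] (X : ℕ → Ω → S) {A : Set S} (hA : MeasurableSet A)
    {τ n t : ℕ} (hn : n = t + τ) :
    Measurable[pastSigma X t] (residueCount X A τ (n % τ) n) := by
  have h : ∀ i ∈ (Finset.range n).filter (fun i => i % τ = n % τ),
      Measurable[pastSigma X t] (fun ω => A.indicator (fun _ => 1) (X i ω) : Ω → ℕ) := by
    intro i hi
    simp only [Finset.mem_filter, Finset.mem_range] at hi
    have hit : i ≤ t := by
      have hd : τ ∣ n - i := (Nat.modEq_iff_dvd' hi.1.le).1 hi.2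
      have := Nat.le_of_dvd (by omega) hd
      omega
    have hX : Measurable[pastSigma X t] (X i) := by
      rw [measurable_iff_comap_le]
      exact le_iSup₂_of_le i hit le_rfl
    exact (measurable_const.indicator hA).comp hX
  have := @Finset.measurable_sum _ _ _ _ _ _ (pastSigma X t) _
    ((Finset.range n).filter (fun i => i % τ = n % τ)) h
  exact this

end Counting

/-! ### Tail recursion and Chernoff bounds under mixing -/

section Chernoff

variable {Ω S : Type*} [MeasurableSpace Ω] [MeasurableSpace S]

theorem cov_le_alphaCoeff (P : Measure Ω) [IsProbabilityMeasure P] (X : ℕ → Ω → S) {τ t : ℕ}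
    {A B : Set Ω} (hA : MeasurableSet[pastSigma X t] A)
    (hB : MeasurableSet[futureSigma X (t + τ)] B) :
    |P.real (A ∩ B) - P.real A * P.real B| ≤ alphaCoeff P X τ := by
  refine le_csSup ⟨1, ?_⟩ ⟨t, A, B, hA, hB, rfl⟩
  rintro r ⟨t, A, B, -, -, rfl⟩
  have h1 : P.real (A ∩ B) ≤ 1 := measureReal_le_one
  have h2 : P.real A ≤ 1 := measureReal_le_one
  have h3 : P.real B ≤ 1 := measureReal_le_one
  have h4 : 0 ≤ P.real (A ∩ B) := measureReal_nonneg
  have h5 : 0 ≤ P.real A := measureReal_nonneg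
  have h6 : 0 ≤ P.real B := measureReal_nonneg
  rw [abs_le]
  constructor <;> nlinarith

theorem alphaCoeff_nonneg (P : Measure Ω) [IsProbabilityMeasure P] (X : ℕ → Ω → S) (τ : ℕ) :
    0 ≤ alphaCoeff P X τ :=
  (abs_nonneg _).trans (cov_le_alphaCoeff (t := 0) P X (@MeasurableSet.empty _ (pastSigma X 0))
    (@MeasurableSet.empty _ (futureSigma X (0 + τ))))

/-- Adding the indicator of an event that is nearly uncorrelated with the past count. -/
theorem measureReal_succ_le_count (P : Measure Ω) [IsProbabilityMeasure P] {T T' : Ω → ℕ}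
    {B : Set Ω} {p a : ℝ} {s : ℕ} (hT : Measurable T)
    (hB : ∀ ω ∈ B, T' ω = T ω + 1) (hBc : ∀ ω ∉ B, T' ω = T ω)
    (hcov : P.real ({ω | T ω = s} ∩ B) ≤ P.real {ω | T ω = s} * p + a) :
    P.real {ω | s + 1 ≤ T' ω}
      ≤ p * P.real {ω | s ≤ T ω} + (1 - p) * P.real {ω | s + 1 ≤ T ω} + a := by
  -- A unit increment reaches s + 1 only from s + 1 or more already, or from exactly s.
  have h1 : {ω | s + 1 ≤ T' ω} ⊆ {ω | s + 1 ≤ T ω} ∪ ({ω | T ω = s} ∩ B) := by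
    intro ω hω
    by_cases h : ω ∈ B
    · have := hB ω h
      simp only [Set.mem_ofPred_eq, Set.mem_union, Set.mem_inter_iff] at hω ⊢
      by_cases h' : s + 1 ≤ T ω
      · exact Or.inl h'
      · exact Or.inr ⟨by omega, h⟩
    · left
      have := hBc ω h
      simp only [Set.mem_ofPred_eq] at hω ⊢
      omega
  have h2 : P.real {ω | s ≤ T ω} = P.real {ω | s + 1 ≤ T ω} + P.real {ω | T ω = s} := by
    rw [← measureReal_union]
    · congr 1
      ext ω
      simp only [Set.mem_ofPred_eq, Set.mem_union]
      omega
    · rw [Set.disjoint_left]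
      intro ω h h'
      simp only [Set.mem_ofPred_eq] at h h'
      omega
    · exact hT (measurableSet_singleton s)
  have h3 := (measureReal_mono (μ := P) h1).trans (measureReal_union_le _ _)
  rw [h2]
  linarith

variable {P : Measure Ω} [IsProbabilityMeasure P] {X : ℕ → Ω → S}

/-- The induction runs on tails rather than on exponential moments: the weights p and 1 − p sum to
1, so past errors are averaged and each step adds a single α(τ), with no exponential factor. -/
theorem measureReal_residueCount_ge (hX : ∀ t, Measurable (X t)) {A : Set S}
    (hA : MeasurableSet A) {p θ : ℝ} (hp : ∀ t, P.real (X t ⁻¹' A) = p) (hθ : 0 ≤ θ) (τ j n s : ℕ) :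
    P.real {ω | s ≤ residueCount X A τ j n ω}
      ≤ Real.exp (-θ * s) * (1 - p + p * Real.exp θ) ^ residueSize τ j n
        + residueSize τ j n * alphaCoeff P X τ := by
  have hp0 : 0 ≤ p := by rw [← hp 0]; exact measureReal_nonneg
  have hp1 : p ≤ 1 := by rw [← hp 0]; exact measureReal_le_one
  have hα := alphaCoeff_nonneg P X τ
  have hM : 1 ≤ 1 - p + p * Real.exp θ := by
    have : 1 ≤ Real.exp θ := Real.one_le_exp hθ
    nlinarith
  induction n generalizing s with
  | zero =>
    rcases Nat.eq_zero_or_pos s with rfl | hs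
    · simp [residueSize]
    · have : {ω | s ≤ residueCount X A τ j 0 ω} = ∅ := by
        ext ω
        simpa [residueCount] using hs.ne'
      rw [this]
      simp [residueSize, Real.exp_nonneg]
  | succ n ih =>
    by_cases hj : n % τ = j
    swap
    · have h1 : ∀ ω, residueCount X A τ j (n + 1) ω = residueCount X A τ j n ω := fun ω => by
        rw [residueCount_succ]; simp [hj]
      have h2 : residueSize τ j (n + 1) = residueSize τ j n := by
        rw [residueSize_succ]; simp [hj]
      simp only [h1, h2]
      exact ih s
    have h2 : residueSize τ j (n + 1) = residueSize τ j n + 1 := by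
      rw [residueSize_succ]; simp [hj]
    rcases s with _ | s
    · have h3 : (1 : ℝ) ≤ (1 - p + p * Real.exp θ) ^ residueSize τ j (n + 1) := one_le_pow₀ hM
      have h4 : 0 ≤ (residueSize τ j (n + 1) : ℝ) * alphaCoeff P X τ := by positivity
      have h5 : P.real {ω | 0 ≤ residueCount X A τ j (n + 1) ω} ≤ 1 := measureReal_le_one
      simp only [Nat.cast_zero, mul_zero, Real.exp_zero, one_mul]
      linarith
    have hmeas : Measurable (residueCount X A τ j n) := by
      unfold residueCount
      exact Finset.measurable_sum _ fun i _ => (measurable_const.indicator hA).comp (hX i)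
    have hcov : P.real ({ω | residueCount X A τ j n ω = s} ∩ X n ⁻¹' A)
        ≤ P.real {ω | residueCount X A τ j n ω = s} * p + alphaCoeff P X τ := by
      rw [← hp n]
      rcases lt_or_ge n τ with hn | hn
      -- The first time of the class has no past, so the count is the constant 0 and the covariance
      -- vanishes.
      · have h0 : ∀ ω, residueCount X A τ j n ω = 0 := by
          intro ω
          unfold residueCount
          rw [Finset.filter_false_of_mem, Finset.sum_empty]
          intro i hi
          have hi := Finset.mem_range.1 hi
          rw [← hj, Nat.mod_eq_of_lt hn, Nat.mod_eq_of_lt (hi.trans hn)]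
          exact hi.ne
        simp only [h0]
        by_cases hs : 0 = s
        · simpa [hs] using hα
        · simpa [hs] using hα
      · obtain ⟨t, rfl⟩ : ∃ t, n = t + τ := ⟨n - τ, by omega⟩
        have hpast : MeasurableSet[pastSigma X t] {ω | residueCount X A τ j (t + τ) ω = s} := by
          rw [← hj]
          exact measurable_residueCount_past X hA rfl (measurableSet_singleton s)
        have hfut : MeasurableSet[futureSigma X (t + τ)] (X (t + τ) ⁻¹' A) := by
          have : Measurable[futureSigma X (t + τ)] (X (t + τ)) := by
            rw [measurable_iff_comap_le]
            exact le_iSup₂_of_le (t + τ) le_rfl le_rfl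
          exact this hA
        have := (abs_le.1 (cov_le_alphaCoeff P X hpast hfut)).2
        linarith
    have hstep := measureReal_succ_le_count P (T := residueCount X A τ j n)
      (T' := residueCount X A τ j (n + 1)) hmeas
      (fun ω hω => by rw [residueCount_succ]; simpa [hj] using hω)
      (fun ω hω => by rw [residueCount_succ]; simpa [hj] using hω) hcov
    refine hstep.trans ?_
    have h6 := mul_le_mul_of_nonneg_left (ih s) hp0
    have h7 := mul_le_mul_of_nonneg_left (ih (s + 1)) (sub_nonneg.2 hp1)
    have h8 : Real.exp (-θ * s) = Real.exp (-θ * (s + 1 : ℕ)) * Real.exp θ := by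
      rw [← Real.exp_add]; congr 1; push_cast; ring
    rw [h8] at h6
    rw [h2, pow_succ]
    rw [Nat.cast_add (residueSize τ j n), Nat.cast_one (R := ℝ)]
    linear_combination h6 + h7

/-- The Chernoff bound for the number of visits, with the sample split into residue classes. -/
theorem measureReal_visitCount_ge (hX : ∀ t, Measurable (X t)) {A : Set S}
    (hA : MeasurableSet A) {p q θ : ℝ} (hp : ∀ t, P.real (X t ⁻¹' A) = p) (hθ : 0 ≤ θ)
    (hq : 0 ≤ q) (hM : Real.exp (-θ * p) * (1 - p + p * Real.exp θ) ≤ Real.exp (q * θ ^ 2))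
    {τ : ℕ} (hτ : 0 < τ) (n : ℕ) (Z : ℝ) :
    P.real {ω | Z ≤ visitCount X A n ω}
      ≤ τ * Real.exp (-θ * ((Z - n * p) / τ) + q * θ ^ 2 * (n / τ + 1))
        + n * alphaCoeff P X τ := by
  have hp0 : 0 ≤ p := by rw [← hp 0]; exact measureReal_nonneg
  have hp1 : p ≤ 1 := by rw [← hp 0]; exact measureReal_le_one
  have hτ' : (0 : ℝ) < τ := by exact_mod_cast hτ
  have hsum : ∑ j ∈ Finset.range τ, (residueSize τ j n : ℝ) = n := by
    exact_mod_cast sum_residueSize hτ n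
  -- Each class gets its own mean plus an equal share of the excess. These thresholds sum to Z, so
  -- some class must reach its own.
  set r : ℕ → ℝ := fun j => residueSize τ j n * p + (Z - n * p) / τ with hr
  have hsub : {ω | Z ≤ visitCount X A n ω}
      ⊆ ⋃ j ∈ Finset.range τ, {ω | ⌈r j⌉₊ ≤ residueCount X A τ j n ω} := by
    intro ω hω
    by_contra hcon
    simp only [Set.mem_iUnion, Set.mem_ofPred_eq, Nat.ceil_le, not_exists, not_le] at hcon hω
    have h1 : ∑ j ∈ Finset.range τ, (residueCount X A τ j n ω : ℝ)
        < ∑ j ∈ Finset.range τ, r j :=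
      Finset.sum_lt_sum_of_nonempty (by simpa using hτ.ne') hcon
    have h2 : ∑ j ∈ Finset.range τ, r j = Z := by
      simp only [hr, Finset.sum_add_distrib, ← Finset.sum_mul, hsum, Finset.sum_const,
        Finset.card_range, nsmul_eq_mul]
      field_simp
      ring
    have h3 : ∑ j ∈ Finset.range τ, (residueCount X A τ j n ω : ℝ) = visitCount X A n ω := by
      exact_mod_cast sum_residueCount hτ X A n ω
    linarith
  have hterm : ∀ j ∈ Finset.range τ, P.real {ω | ⌈r j⌉₊ ≤ residueCount X A τ j n ω}
      ≤ Real.exp (-θ * ((Z - n * p) / τ) + q * θ ^ 2 * (n / τ + 1))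
        + residueSize τ j n * alphaCoeff P X τ := by
    intro j _
    refine (measureReal_residueCount_ge hX hA hp hθ τ j n _).trans ?_
    gcongr
    have hM0 : 0 ≤ 1 - p + p * Real.exp θ := by
      have := Real.exp_nonneg θ
      have := mul_nonneg hp0 this
      linarith
    calc Real.exp (-θ * ⌈r j⌉₊) * (1 - p + p * Real.exp θ) ^ residueSize τ j n
        ≤ Real.exp (-θ * r j) * (1 - p + p * Real.exp θ) ^ residueSize τ j n := by
          refine mul_le_mul_of_nonneg_right (Real.exp_le_exp.2 ?_) (by positivity)
          nlinarith [Nat.le_ceil (r j)]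
      _ = Real.exp (-θ * ((Z - n * p) / τ))
          * (Real.exp (-θ * p) * (1 - p + p * Real.exp θ)) ^ residueSize τ j n := by
          rw [mul_pow, ← Real.exp_nat_mul, ← mul_assoc, ← Real.exp_add]
          congr 2
          simp only [hr]
          ring
      _ ≤ Real.exp (-θ * ((Z - n * p) / τ)) * Real.exp (q * θ ^ 2) ^ residueSize τ j n := by
          gcongr
      _ ≤ _ := by
          rw [← Real.exp_nat_mul, ← Real.exp_add]
          refine Real.exp_le_exp.2 ?_
          have := mul_le_mul_of_nonneg_left (residueSize_le τ j n)
            (by positivity : 0 ≤ q * θ ^ 2)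
          linarith
  calc P.real {ω | Z ≤ visitCount X A n ω}
      ≤ ∑ j ∈ Finset.range τ, P.real {ω | ⌈r j⌉₊ ≤ residueCount X A τ j n ω} :=
        (measureReal_mono hsub (measure_ne_top P _)).trans (measureReal_biUnion_finset_le _ _)
    _ ≤ _ := Finset.sum_le_sum hterm
    _ = _ := by
        rw [Finset.sum_add_distrib, ← Finset.sum_mul, hsum]
        simp

/-- Upper tail of the number of visits. -/
theorem measureReal_visitCount_ge_of_le (hX : ∀ t, Measurable (X t)) {A : Set S}
    (hA : MeasurableSet A) {q : ℝ} (hq : ∀ t, P.real (X t ⁻¹' A) = q) {τ n : ℕ}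
    (hτ : 0 < τ) (hn : 24 * τ ≤ n) {ζ L : ℝ} (hL : 0 < L) (hζ : 36 * τ * L ≤ ζ)
    (hdev : n * q ≤ ζ - 5 * √(ζ * τ * L)) :
    P.real {ω | ζ ≤ visitCount X A n ω}
      ≤ τ * Real.exp (-(3 * L)) + n * alphaCoeff P X τ := by
  have hq0 : 0 ≤ q := by rw [← hq 0]; exact measureReal_nonneg
  have hτ' : (0 : ℝ) < τ := by exact_mod_cast hτ
  have hn' : (24 : ℝ) * τ ≤ n := by exact_mod_cast hn
  have hζ0 : 0 < ζ := lt_of_lt_of_le (by positivity) hζ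
  set R := √(ζ * τ * L) with hR
  have hR0 : 0 ≤ R := Real.sqrt_nonneg _
  have hRR : R ^ 2 = ζ * τ * L := Real.sq_sqrt (by positivity)
  have hR6 : R ≤ ζ / 6 := by
    rw [hR]
    refine Real.sqrt_le_iff.2 ⟨by positivity, ?_⟩
    nlinarith
  -- This choice gives θ²ζ = θR = τL: the deviation 5R contributes −5L and the quadratic term at
  -- most 2L, leaving −3L.
  set θ := R / ζ with hθdef
  have hθ0 : 0 ≤ θ := by positivity
  have hθ1 : θ ≤ 1 := by rw [hθdef, div_le_one hζ0]; linarith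
  have hM : Real.exp (-θ * q) * (1 - q + q * Real.exp θ) ≤ Real.exp (q * θ ^ 2) := by
    have h1 : Real.exp θ ≤ 1 + θ + θ ^ 2 := by
      have := Real.abs_exp_sub_one_sub_id_le (x := θ) (by rwa [abs_of_nonneg hθ0])
      have := (abs_le.1 this).2
      linarith
    have h2 : 1 - q + q * Real.exp θ ≤ Real.exp (θ * q + q * θ ^ 2) := by
      refine le_trans ?_ (Real.add_one_le_exp _)
      nlinarith
    calc _ ≤ Real.exp (-θ * q) * Real.exp (θ * q + q * θ ^ 2) := by gcongr
      _ = _ := by rw [← Real.exp_add]; congr 1; ring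
  refine (measureReal_visitCount_ge hX hA hq hθ0 hq0 hM hτ n ζ).trans ?_
  gcongr
  have hθ2 : θ ^ 2 * ζ = τ * L := by
    rw [hθdef, div_pow, hRR]; field_simp
  have hθR : θ * R = τ * L := by
    rw [hθdef, div_mul_eq_mul_div, ← sq, hRR]; field_simp
  have h3 : 5 * L ≤ θ * ((ζ - n * q) / τ) := by
    have h5 : θ * (5 * R) ≤ θ * (ζ - n * q) := mul_le_mul_of_nonneg_left (by linarith) hθ0
    rw [← mul_div_assoc, le_div_iff₀ hτ']
    linarith
  have h4 : q * θ ^ 2 * (n / τ + 1) ≤ 2 * L := by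
    have h5 : (n : ℝ) / τ + 1 ≤ 2 * n / τ := by
      rw [div_add_one hτ'.ne']
      gcongr
      linarith
    calc q * θ ^ 2 * (n / τ + 1) ≤ q * θ ^ 2 * (2 * n / τ) := by gcongr
      _ = θ ^ 2 * (n * q) * 2 / τ := by ring
      _ ≤ θ ^ 2 * ζ * 2 / τ := by gcongr; linarith
      _ = 2 * L := by rw [hθ2]; field_simp
  linarith

/-- Lower tail of the number of visits. -/
theorem measureReal_visitCount_le_of_ge (hX : ∀ t, Measurable (X t)) {A : Set S}
    (hA : MeasurableSet A) {q : ℝ} (hq : ∀ t, P.real (X t ⁻¹' A) = q) {τ n : ℕ}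
    (hτ : 0 < τ) (hn : 24 * τ ≤ n) {ζ L : ℝ} (hL : 0 < L) (hζ : 36 * τ * L ≤ ζ)
    (hdev : ζ + 6 * √(ζ * τ * L) ≤ n * q) :
    P.real {ω | visitCount X A n ω ≤ ζ}
      ≤ τ * Real.exp (-(3 * L)) + n * alphaCoeff P X τ := by
  have hq0 : 0 ≤ q := by rw [← hq 0]; exact measureReal_nonneg
  have hτ' : (0 : ℝ) < τ := by exact_mod_cast hτ
  have hn' : (24 : ℝ) * τ ≤ n := by exact_mod_cast hn
  have hζ0 : 0 < ζ := lt_of_lt_of_le (by positivity) hζ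
  set R := √(ζ * τ * L) with hR
  have hR0 : 0 ≤ R := Real.sqrt_nonneg _
  have hRR : R ^ 2 = ζ * τ * L := Real.sq_sqrt (by positivity)
  set e := n * q - ζ with he
  have heR : 6 * R ≤ e := by linarith
  have he0 : 0 ≤ e := by linarith
  have hμ0 : 0 < n * q := by linarith
  -- With nq = ζ + e, half of e² covers 18R² = 18τLζ because e ≥ 6R, and the other half covers 18τLe
  -- because also R ≥ 6τL.
  have hkey : 18 * (τ * L) * (n * q) ≤ e ^ 2 := by
    have h6 : 6 * (τ * L) ≤ R := by
      refine Real.le_sqrt_of_sq_le ?_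
      nlinarith [mul_le_mul_of_nonneg_right hζ (by positivity : 0 ≤ τ * L)]
    have h7 : n * q = ζ + e := by rw [he]; ring
    rw [h7]
    nlinarith [mul_le_mul_of_nonneg_right h6 he0, mul_le_mul_of_nonneg_right heR he0,
      mul_le_mul_of_nonneg_left heR hR0]
  set θ := e / (3 * (n * q)) with hθdef
  have hθ0 : 0 ≤ θ := by positivity
  have hqc : ∀ t, P.real (X t ⁻¹' Aᶜ) = 1 - q := fun t => by
    rw [Set.preimage_compl, probReal_compl_eq_one_sub (hX t hA), hq]
  -- The lower tail for A is the upper tail for its complement. The centred moment at θ is that of A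
  -- at −θ, so the variance proxy remains q instead of 1 − q.
  have hM : Real.exp (-θ * (1 - q)) * (1 - (1 - q) + (1 - q) * Real.exp θ)
      ≤ Real.exp (q * θ ^ 2) := by
    have h1 : Real.exp (-θ) ≤ 1 - θ + θ ^ 2 := by
      rcases le_or_gt θ 1 with h | h
      · have := Real.abs_exp_sub_one_sub_id_le (x := -θ) (by rwa [abs_neg, abs_of_nonneg hθ0])
        have := (abs_le.1 this).2
        linarith
      · have : Real.exp (-θ) ≤ 1 := Real.exp_le_one_iff.2 (by linarith)
        nlinarith
    have h2 : 1 - q + q * Real.exp (-θ) ≤ Real.exp (-(θ * q) + q * θ ^ 2) := by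
      refine le_trans ?_ (Real.add_one_le_exp _)
      nlinarith
    calc _ = Real.exp (θ * q) * (1 - q + q * Real.exp (-θ)) := by
          have h3 : Real.exp (-θ * (1 - q)) = Real.exp (θ * q) * Real.exp (-θ) := by
            rw [← Real.exp_add]; congr 1; ring
          have h4 : Real.exp (-θ) * Real.exp θ = 1 := by
            rw [← Real.exp_add]; simp
          rw [h3]
          linear_combination (1 - q) * Real.exp (θ * q) * h4
      _ ≤ Real.exp (θ * q) * Real.exp (-(θ * q) + q * θ ^ 2) := by gcongr
      _ = _ := by rw [← Real.exp_add]; congr 1; ring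
  have hset : {ω | (visitCount X A n ω : ℝ) ≤ ζ} = {ω | n - ζ ≤ visitCount X Aᶜ n ω} := by
    ext ω
    have : (visitCount X A n ω : ℝ) + visitCount X Aᶜ n ω = n := by
      exact_mod_cast visitCount_compl X A n ω
    simp only [Set.mem_ofPred_eq]
    constructor <;> intro _ <;> linarith
  rw [hset]
  refine (measureReal_visitCount_ge hX hA.compl hqc hθ0 hq0 hM hτ n (n - ζ)).trans ?_
  gcongr
  have h5 : (n : ℝ) / τ + 1 ≤ 25 / 24 * n / τ := by
    rw [div_add_one hτ'.ne']
    gcongr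
    linarith
  have h6 : q * θ ^ 2 * (n / τ + 1) ≤ q * θ ^ 2 * (25 / 24 * n / τ) := by gcongr
  -- Here 47/216 = 1/3 − 25/(24·9), and 18 · 47/216 > 3.
  have h7 : -θ * ((n - ζ - n * (1 - q)) / τ) + q * θ ^ 2 * (25 / 24 * n / τ)
      = -(47 / 216) * (e ^ 2 / (τ * (n * q))) := by
    have h8 : (n : ℝ) - ζ - n * (1 - q) = e := by rw [he]; ring
    have h9 : (n : ℝ) ≠ 0 := left_ne_zero_of_mul hμ0.ne'
    have h10 : q ≠ 0 := right_ne_zero_of_mul hμ0.ne'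
    rw [h8, hθdef]
    generalize e = e
    field_simp
    ring
  have h8 : 18 * L ≤ e ^ 2 / (τ * (n * q)) := by
    rw [le_div_iff₀ (by positivity)]
    linarith
  linarith

end Chernoff

/-! ### Packing light symbols, and the mixing time -/

/-- Items of weight at most `a` fit into any number `K ≥ W / a` of bins of capacity `2 a`, where
`W` bounds the total weight. -/
theorem exists_bins {S : Type*} [DecidableEq S] (w : S → ℝ) {a W : ℝ} {K : ℕ} (ha : 0 ≤ a)
    (hK : 0 < K) (hW : W ≤ K * a) (s : Finset S) (hw : ∀ x ∈ s, w x ≤ a)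
    (hw0 : ∀ x ∈ s, 0 ≤ w x) (hs : ∑ x ∈ s, w x ≤ W) :
    ∃ f : S → Fin K, ∀ b, ∑ x ∈ s with f x = b, w x ≤ 2 * a := by
  induction s using Finset.induction_on with
  | empty => exact ⟨fun _ => ⟨0, hK⟩, by simp [ha]⟩
  | insert y s hy ih =>
    rw [Finset.sum_insert hy] at hs
    have hy0 := hw0 y (Finset.mem_insert_self y s)
    obtain ⟨f, hf⟩ := ih (fun x hx => hw x (Finset.mem_insert_of_mem hx))
      (fun x hx => hw0 x (Finset.mem_insert_of_mem hx)) (by linarith)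
    have : Nonempty (Fin K) := ⟨⟨0, hK⟩⟩
    -- The average load is at most W/K ≤ a, so some bin has room for one more item.
    obtain ⟨b, -, hb⟩ : ∃ b ∈ (Finset.univ : Finset (Fin K)), ∑ x ∈ s with f x = b, w x ≤ a := by
      refine Finset.exists_le_of_sum_le Finset.univ_nonempty ?_
      rw [Finset.sum_fiberwise]
      simp only [Finset.sum_const, Finset.card_univ, Fintype.card_fin, nsmul_eq_mul]
      linarith
    refine ⟨Function.update f y b, fun c => ?_⟩
    have hs' : s.filter (fun x => Function.update f y b x = c) = s.filter (fun x => f x = c) :=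
      Finset.filter_congr fun x hx => by
        rw [Function.update_of_ne (ne_of_mem_of_not_mem hx hy)]
    rw [Finset.filter_insert, hs', Function.update_self]
    split_ifs with h
    · subst h
      rw [Finset.sum_insert (by simp [hy])]
      have := hw y (Finset.mem_insert_self y s)
      linarith
    · exact hf c

/-- Exponential decay makes the defining set nonempty, so its infimum is attained and is not the
default value 0. -/
theorem mixTime_spec {Ω S : Type*} [MeasurableSpace Ω] [MeasurableSpace S] {P : Measure Ω}
    {X : ℕ → Ω → S} (h : IsExpAlphaMixing P X) {ε : ℝ} (hε : 0 < ε) :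
    1 ≤ mixTime P X ε ∧ alphaCoeff P X (mixTime P X ε) ≤ ε := by
  obtain ⟨c, ρ, hc, hρ0, hρ1, hα⟩ := h
  refine Nat.sInf_mem (s := {τ : ℕ | 1 ≤ τ ∧ alphaCoeff P X τ ≤ ε}) ?_
  obtain ⟨k, hk⟩ := exists_pow_lt_of_lt_one (div_pos hε hc) hρ1
  refine ⟨k + 1, by omega, (hα (k + 1) (by omega)).trans ?_⟩
  have h1 : ρ ^ (k + 1) ≤ ρ ^ k := pow_le_pow_of_le_one hρ0.le hρ1.le (Nat.le_succ k)
  rw [lt_div_iff₀ hc] at hk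
  nlinarith

/-! ### From single symbols to the estimation error -/

section Sample

variable {Ω S : Type*} [DecidableEq S]

theorem occCount_sample (X : ℕ → Ω → S) (n : ℕ) (ω : Ω) (x : S) :
    occCount (sample X n ω) x = visitCount X {x} n ω := by
  rw [occCount, visitCount, Finset.card_filter, ← Fin.sum_univ_eq_sum_range
    (fun i => ({x} : Set S).indicator (fun _ => 1) (X i ω))]
  refine Finset.sum_congr rfl fun i _ => ?_
  by_cases h : X i ω = x <;> simp [sample, h]

theorem abs_countMass_sub_plugIn_le [Fintype S] [MeasurableSpace S] {π : Measure S} {n : ℕ}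
    {z : Fin n → S} {ζ : ℕ} {D : ℝ}
    (h : ∀ x, occCount z x = ζ → |π.real {x} - (ζ : ℝ) / n| ≤ D) :
    |countMass π z ζ - plugIn z ζ| ≤ prevalence z ζ * D := by
  have h1 : countMass π z ζ - plugIn z ζ
      = ∑ x : S with occCount z x = ζ, (π.real {x} - (ζ : ℝ) / n) := by
    rw [Finset.sum_sub_distrib, countMass, plugIn, prevalence]
    simp [Finset.sum_filter]
  rw [h1]
  refine (Finset.abs_sum_le_sum_abs _ _).trans ?_
  refine (Finset.sum_le_card_nsmul _ _ D fun x hx => h x (Finset.mem_filter.1 hx).2).trans ?_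
  rw [nsmul_eq_mul, prevalence]

end Sample

/-- Outside an event of small probability, every symbol seen exactly `ζ` times has probability
close to `ζ / n`. -/
theorem exists_exceptional_set {Ω S : Type*} [MeasurableSpace Ω] [Fintype S]
    [MeasurableSpace S] [MeasurableSingletonClass S] {P : Measure Ω} [IsProbabilityMeasure P]
    {π : Measure S} {X : ℕ → Ω → S} (hX : ∀ t, Measurable (X t)) (hlaw : ∀ t, HasLaw (X t) π P)
    {τ n : ℕ} (hτ : 0 < τ) (hn : 24 * τ ≤ n) {ζ L : ℝ} (hL : 1 ≤ L) (hζ : 36 * τ * L ≤ ζ) :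
    ∃ E : Set Ω, P.real E ≤ 2 * n * (τ * Real.exp (-(3 * L)) + n * alphaCoeff P X τ) ∧
      ∀ ω ∉ E, ∀ x, (visitCount X {x} n ω : ℝ) = ζ →
        |n * π.real {x} - ζ| ≤ 6 * √(ζ * τ * L) := by
  classical
  have hπ : IsProbabilityMeasure π := by
    rw [← (hlaw 0).map_eq]
    exact Measure.isProbabilityMeasure_map (hX 0).aemeasurable
  have hτ1 : (1 : ℝ) ≤ τ := by exact_mod_cast hτ
  have hn' : (24 : ℝ) * τ ≤ n := by exact_mod_cast hn
  have hn0 : (0 : ℝ) < n := by linarith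
  have hζ36 : 36 ≤ ζ := by nlinarith
  have hL0 : 0 < L := by linarith
  have hR6 : √(ζ * τ * L) ≤ ζ / 6 := by
    refine Real.sqrt_le_iff.2 ⟨by positivity, ?_⟩
    nlinarith
  have hR0 : 0 ≤ √(ζ * τ * L) := Real.sqrt_nonneg _
  have hprob : ∀ (A : Set S) t, P.real (X t ⁻¹' A) = π.real A := fun A t => by
    rw [← (hlaw t).map_eq, map_measureReal_apply (hX t) (Set.toFinite A).measurableSet]
  have hsum : ∀ s : Finset S, ∑ x ∈ s, π.real {x} = π.real s := fun s =>
    sum_measureReal_singleton s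
  set β := τ * Real.exp (-(3 * L)) + n * alphaCoeff P X τ with hβ
  have hβ0 : 0 ≤ β := by have := alphaCoeff_nonneg P X τ; positivity
  set light : Finset S := Finset.univ.filter fun x => π.real {x} ≤ 1 / n with hlight
  set heavy : Finset S := Finset.univ.filter fun x => 1 / n < π.real {x} ∧
    6 * √(ζ * τ * L) < |n * π.real {x} - ζ| with hheavy
  obtain ⟨f, hf⟩ := exists_bins (fun x => π.real {x}) (a := 1 / n) (W := 1) (K := n)
    (by positivity) (by exact_mod_cast hn0) (by field_simp; rfl) light
    (fun x hx => (Finset.mem_filter.1 hx).2) (fun x _ => measureReal_nonneg)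
    (by rw [hsum]; exact measureReal_le_one)
  let bin : Fin n → Set S := fun b => (light.filter fun x => f x = b : Finset S)
  have hbin : ∀ b ∈ (Finset.univ : Finset (Fin n)),
      P.real {ω | ζ ≤ visitCount X (bin b) n ω} ≤ β := by
    intro b _
    refine measureReal_visitCount_ge_of_le hX (Set.toFinite _).measurableSet
      (hprob _) hτ hn hL0 hζ ?_
    have h1 : π.real (bin b) ≤ 2 * (1 / n) := by rw [← hsum]; exact hf b
    have h2 : n * π.real (bin b) ≤ 2 := by
      calc n * π.real (bin b) ≤ n * (2 * (1 / n)) := by gcongr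
        _ = 2 := by field_simp
    -- Since √(ζτL) ≤ ζ/6 and ζ ≥ 36, the right-hand side is at least ζ/6 ≥ 6 > 2.
    linarith
  have hheavy_le : ∀ x ∈ heavy, P.real {ω | (visitCount X {x} n ω : ℝ) = ζ} ≤ β := by
    intro x hx
    have hdev := (Finset.mem_filter.1 hx).2.2
    rcases lt_abs.1 hdev with h | h
    · refine (measureReal_mono ?_).trans (measureReal_visitCount_le_of_ge hX
        (measurableSet_singleton x) (hprob {x}) hτ hn hL0 hζ (by linarith))
      exact fun ω hω => le_of_eq hω
    · refine (measureReal_mono ?_).trans (measureReal_visitCount_ge_of_le hX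
        (measurableSet_singleton x) (hprob {x}) hτ hn hL0 hζ (by linarith))
      exact fun ω hω => ge_of_eq hω
  have hcard : (heavy.card : ℝ) ≤ n := by
    have h1 : heavy.card • (1 / (n : ℝ)) ≤ ∑ x ∈ heavy, π.real {x} :=
      Finset.card_nsmul_le_sum _ _ _ fun x hx => (Finset.mem_filter.1 hx).2.1.le
    rw [hsum, nsmul_eq_mul, mul_one_div] at h1
    have := (div_le_one hn0).1 (h1.trans measureReal_le_one)
    exact this
  refine ⟨(⋃ b ∈ (Finset.univ : Finset (Fin n)), {ω | ζ ≤ visitCount X (bin b) n ω}) ∪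
    ⋃ x ∈ heavy, {ω | (visitCount X {x} n ω : ℝ) = ζ}, ?_, ?_⟩
  · have h1 := (measureReal_biUnion_finset_le (μ := P) Finset.univ
      fun b => {ω | ζ ≤ visitCount X (bin b) n ω}).trans (Finset.sum_le_card_nsmul _ _ _ hbin)
    have h2 := (measureReal_biUnion_finset_le (μ := P) heavy
      fun x => {ω | (visitCount X {x} n ω : ℝ) = ζ}).trans
        (Finset.sum_le_card_nsmul _ _ _ hheavy_le)
    rw [nsmul_eq_mul] at h1 h2
    rw [Finset.card_univ, Fintype.card_fin] at h1
    have h3 := mul_le_mul_of_nonneg_right hcard hβ0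
    refine (measureReal_union_le _ _).trans ?_
    linarith
  · intro ω hω x hx
    simp only [Set.mem_union, Set.mem_iUnion, Set.mem_ofPred_eq, not_or, not_exists] at hω
    by_contra hcon
    rw [not_le] at hcon
    rcases le_or_gt (π.real {x}) (1 / n) with h | h
    · refine hω.1 (f x) (Finset.mem_univ _) ?_
      rw [← hx]
      refine Nat.cast_le.2 (visitCount_mono X ?_ n ω)
      simpa [bin, hlight] using h
    · exact hω.2 x (Finset.mem_filter.2 ⟨Finset.mem_univ x, h, hcon⟩) hx

end FreqMass

/-! ### Choice of constants -/

theorem proposition1 :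
    ∃ C : ℝ, 0 < C ∧
      ∀ (Ω : Type*) (S : Type*) [MeasurableSpace Ω] [Fintype S] [DecidableEq S]
        [MeasurableSpace S] [MeasurableSingletonClass S]
        (P : Measure Ω) [IsProbabilityMeasure P] (π : Measure S) (X : ℕ → Ω → S),
        (∀ t, Measurable (X t)) →
        (∀ t, HasLaw (X t) π P) →
        FreqMass.IsExpAlphaMixing P X →
        ∀ (δ ε : ℝ), 0 < δ → 0 < ε → ∀ (n τ₀ : ℕ), 0 < n →
          τ₀ = FreqMass.mixTime P X (ε / (n : ℝ) ^ 2) →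
          24 * τ₀ ≤ n →
          ∀ ζ : ℕ,
            max (36 * (τ₀ : ℝ) * Real.log (22 * n / δ))
              (1 + √((4 + 8 * (τ₀ : ℝ)) * Real.log (11 * n / δ))
                + 4 * (τ₀ : ℝ) * Real.log (11 * n / δ) / 3) ≤ (ζ : ℝ) →
            1 - δ - 3 * ε ≤ P.real {ω |
              |FreqMass.countMass π (FreqMass.sample X n ω) ζ
                  - FreqMass.plugIn (FreqMass.sample X n ω) ζ|
                ≤ C * (√((ζ : ℝ) * (τ₀ : ℝ))
                    * (FreqMass.prevalence (FreqMass.sample X n ω) ζ : ℝ) / (n : ℝ)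
                    * √(Real.log (C * n / δ)))} := by
  -- The value 22 matches the logarithm in the lower bound on ζ, and exceeds the factor 6 of the
  -- deviation bound.
  refine ⟨22, by norm_num, ?_⟩
  intro Ω S _ _ _ _ _ P _ π X hX hlaw hmix δ ε hδ hε n τ₀ hn hτ₀ hnτ ζ hζ
  rcases le_or_gt 1 δ with hδ1 | hδ1
  · exact le_trans (by linarith) measureReal_nonneg
  have hnR : (0 : ℝ) < n := by exact_mod_cast hn
  have hn1 : (1 : ℝ) ≤ n := by exact_mod_cast hn
  obtain ⟨hτ1, hα⟩ := FreqMass.mixTime_spec hmix (ε := ε / (n : ℝ) ^ 2) (by positivity)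
  rw [← hτ₀] at hτ1 hα
  have harg : 22 ≤ 22 * (n : ℝ) / δ := by
    rw [le_div_iff₀ hδ]
    nlinarith
  set L := Real.log (22 * n / δ) with hL
  have hL1 : 1 ≤ L := by
    rw [hL, Real.le_log_iff_exp_le (by positivity)]
    linarith [Real.exp_one_lt_d9]
  have hexp : Real.exp (-(3 * L)) = (δ / (22 * n)) ^ 3 := by
    rw [Real.exp_neg, show (3 : ℝ) * L = ((3 : ℕ) : ℝ) * L by norm_num, Real.exp_nat_mul, hL,
      Real.exp_log (by positivity), ← inv_pow, inv_div]
  obtain ⟨E, hE, hgood⟩ := FreqMass.exists_exceptional_set hX hlaw hτ1 hnτ hL1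
    ((le_max_left _ _).trans hζ)
  have hPE : P.real E ≤ δ + 3 * ε := by
    refine hE.trans ?_
    have hτn : (τ₀ : ℝ) ≤ n := by exact_mod_cast (by omega : τ₀ ≤ n)
    -- Level ε/n² for the mixing time pays for 2n events with n mixing errors each.
    have h1 : 2 * (n : ℝ) * (n * FreqMass.alphaCoeff P X τ₀) ≤ 2 * ε := by
      calc 2 * (n : ℝ) * (n * FreqMass.alphaCoeff P X τ₀)
          ≤ 2 * (n : ℝ) * (n * (ε / (n : ℝ) ^ 2)) := by gcongr
        _ = 2 * ε := by field_simp
    have h2 : 2 * (n : ℝ) * (τ₀ * Real.exp (-(3 * L))) ≤ δ := by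
      rw [hexp]
      calc 2 * (n : ℝ) * (τ₀ * (δ / (22 * n)) ^ 3)
          ≤ 2 * (n : ℝ) * (n * (δ / (22 * n)) ^ 3) := by gcongr
        _ = δ * (2 / 22 ^ 3 * (δ ^ 2 * (1 / n))) := by field_simp
        _ ≤ δ * (2 / 22 ^ 3 * (1 ^ 2 * 1)) := by
            gcongr
            rw [div_le_one hnR]; exact hn1
        _ ≤ δ := by linarith
    linarith
  have hsub : Eᶜ ⊆ {ω |
      |FreqMass.countMass π (FreqMass.sample X n ω) ζ
          - FreqMass.plugIn (FreqMass.sample X n ω) ζ|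
        ≤ 22 * (√((ζ : ℝ) * (τ₀ : ℝ))
            * (FreqMass.prevalence (FreqMass.sample X n ω) ζ : ℝ) / (n : ℝ) * √L)} := by
    intro ω hω
    refine (FreqMass.abs_countMass_sub_plugIn_le (D := 6 * √(ζ * τ₀ * L) / n)
      fun x hx => ?_).trans ?_
    · rw [FreqMass.occCount_sample] at hx
      have h1 := hgood ω hω x (by rw [hx])
      rw [show π.real {x} - (ζ : ℝ) / n = (n * π.real {x} - ζ) / n by field_simp, abs_div,
        abs_of_pos hnR]
      gcongr
    · rw [Real.sqrt_mul (by positivity)]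
      have h2 : 0 ≤ √((ζ : ℝ) * τ₀)
          * (FreqMass.prevalence (FreqMass.sample X n ω) ζ : ℝ) / n * √L := by positivity
      calc (FreqMass.prevalence (FreqMass.sample X n ω) ζ : ℝ)
            * (6 * (√((ζ : ℝ) * τ₀) * √L) / n)
          = 6 * (√((ζ : ℝ) * τ₀)
            * (FreqMass.prevalence (FreqMass.sample X n ω) ζ : ℝ) / n * √L) := by ring
        _ ≤ _ := by linarith
  have h1 : (1 : ℝ) ≤ P.real E + P.real Eᶜ := by
    calc (1 : ℝ) = P.real (E ∪ Eᶜ) := by simp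
      _ ≤ _ := measureReal_union_le _ _
  have h2 := measureReal_mono (μ := P) hsub
  linarith
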